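/- **Setting.** Let $N$ vehicles $i\in\mathcal V=\{1,\dots,N\}$ have longitudinal and lateral positions $x_i(t),y_i(t)\in\mathbb R$ with dynamics $\dot x_i=u_{i,x}$, $\dot y_i=u_{i,y}$. Let $0<r<\rho<R$, $c>0$, $v_d>0$, $y_d\in\mathbb R$, and let a virtual target move by $\dot x_d=v_d$ on the lane $y_d$. Put $$\phi_{i,c}(\sigma)=|\sigma-y_d|,\qquad \phi_{i,m}(\sigma)=|\sigma-x_d|,\qquad \phi_{i,j}(\sigma)=\frac1{|\sigma-x_j|-r}-\frac1{\rho-r},\qquad \mathcal N_i=\{j\ne i:\ |x_i-x_j|\le R\}.$$ The merging problem of vehicle $i$ (with $\gamma(\phi)=\phi$) is the quadratic program $$\min\ (u_{i,x}-v_d)^2+u_{i,y}^2+c\Big[\delta_{i,m}^2+\delta_{i,c}^2+\sum_{j\in\mathcal N_i}\delta_{i,j}^2\Big]$$ over $u_{i,x},u_{i,y}\in\mathbb R$ and slacks $\delta_{i,m},\delta_{i,c},\delta_{i,j}\ge 0$, subject to $$\phi_{i,c}'(y_i)\,u_{i,y}\le-\phi_{i,c}(y_i)+\delta_{i,c},\qquad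 \phi_{i,m}'(x_i)(u_{i,x}-v_d)\le-\phi_{i,m}(x_i)+\delta_{i,m},\qquad \phi_{i,j}'(x_i)(u_{i,x}-v_d)\le-\phi_{i,j}(x_i)+\delta_{i,j}\quad(j\in\mathcal N_i),$$ where at the kink of $|\cdot|$ the derivative may be any subgradient. The optimal inputs depend discontinuously on the positions, so the closed-loop equations are understood as follows: the positions are locally absolutely continuous on $[T_1,\infty)$, and for almost every $t>T_1$ the vector of velocities of all vehicles belongs to $\bigcap_{\varepsilon>0}\overline{\mathrm{conv}}$ of the set of optimal input vectors at positions within $\varepsilon$ of the current ones (Krasovskii solutions). In particular every solution for which $\dot x_i=u_{i,x}$, $\dot y_i=u_{i,y}$ hold at almost every time with optimal inputs is included. **Theorem.** Let the vehicles be governed by this closed loop from time $T_1$ on, and let $|x_i(T_1)-x_j(T_1)|\ge\rho$ for all $i\ne j$. Then the merging problem splits: a decision is optimal if and only if its part $(u_{i,y},\delta_{i,c})$ minimizes $u_{i,y}^2+c\,\delta_{i,c}^2$ under the first constraint, and its part $(u_{i,x},\delta_{i,m},(\delta_{i,j})_j)$ minimizes $(u_{i,x}-v_d)^2+c[\delta_{i,m}^2+\sum_{j\in\mathcal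 N_i}\delta_{i,j}^2]$ under the remaining constraints (each part with its slacks nonnegative). Moreover: 1. $\lim_{t\to\infty}y_i(t)=y_d$ for all $i$; 2. there is an ordering $s[1],\dots,s[N]$ of the vehicles, not prescribed in advance, such that $x_{s[1]}(t)>\dots>x_{s[N]}(t)$ for all $t\ge T_1$, and for each $k=1,\dots,N-1$ the limit $\lim_{t\to\infty}|x_{s[k]}(t)-x_{s[k+1]}(t)|$ exists and lies in $(r,\rho)$; 3. $\lim_{t\to\infty}\dot x_i(t)=v_d$ for all $i$, the limit being over the almost all times at which the velocity exists; 4. $|x_i(t)-x_j(t)|\ge r$ for all $i\ne j$ and all $t\ge T_1$. -/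

import Mathlib

open Filter Topology MeasureTheory

namespace Platoon

/-- Constants of the platoon: safe distance `r`, spacing constant `ρ`, sensing radius `R`,
weight `c` of the slack variables, cruising velocity `vd`, lateral coordinate `yd` of the
desired lane. -/
structure Params where
  r : ℝ
  ρ : ℝ
  R : ℝ
  c : ℝ
  vd : ℝ
  yd : ℝ

/-- Lateral-convergence error `σ ↦ |σ - yd|`. -/
def lateralErr (yd σ : ℝ) : ℝ := |σ - yd|

/-- Longitudinal target-attraction error `σ ↦ |σ - xd|`. -/
def attractionErr (xd σ : ℝ) : ℝ := |σ - xd|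

/-- Collision-avoidance error `σ ↦ 1 / (|σ - xj| - r) - 1 / (ρ - r)`. -/
noncomputable def collisionErr (r ρ xj σ : ℝ) : ℝ := 1 / (|σ - xj| - r) - 1 / (ρ - r)

/-- Longitudinal sensing neighbours of vehicle `i`: all `j ≠ i` with `|x i - x j| ≤ R`. -/
noncomputable def neighbors {N : ℕ} (R : ℝ) (x : Fin N → ℝ) (i : Fin N) : Finset (Fin N) :=
  Finset.univ.filter (fun j => j ≠ i ∧ |x i - x j| ≤ R)

/-- `g` is a subgradient of `f` at `p`. For the convex functions `|· - a|` this is the derivative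
away from `a`, and any number of `[-1, 1]` at the kink `a`, where no derivative exists. -/
def IsSubgradient (f : ℝ → ℝ) (p g : ℝ) : Prop := ∀ σ, f p + g * (σ - p) ≤ f σ

/-- Unknowns of the lateral problem: lateral input and slack of the lateral convergence. -/
structure LatDecision where
  uy : ℝ
  δc : ℝ

/-- Unknowns of the longitudinal problem: longitudinal input, slack of the target attraction and
slacks of the collision avoidance. Only the entries `δ j` with `j` a neighbour occur in the cost
and in the constraints. -/
structure LonDecision (N : ℕ) where
  ux : ℝ
  δm : ℝ
  δ : Fin N → ℝ

/-- Unknowns of the full merging problem. -/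
structure Decision (N : ℕ) extends LatDecision, LonDecision N

/-- Lateral-convergence constraint at the lateral position `y`; `gc` is the slope of the
lateral-convergence error at `y`. -/
def latFeasible (P : Params) (γ : ℝ → ℝ) (y gc : ℝ) : Set LatDecision :=
  {w | 0 ≤ w.δc ∧ gc * w.uy ≤ -γ (lateralErr P.yd y) + w.δc}

def latCost (P : Params) (w : LatDecision) : ℝ := w.uy ^ 2 + P.c * w.δc ^ 2

/-- Target-attraction and collision-avoidance constraints of vehicle `i` when the longitudinal
positions are `x` and the virtual target is at `xd`; `gm` is the slope of the target-attraction
error at `x i`. -/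
def lonFeasible {N : ℕ} (P : Params) (γ : ℝ → ℝ) (xd : ℝ) (x : Fin N → ℝ) (i : Fin N) (gm : ℝ) :
    Set (LonDecision N) :=
  {w | (0 ≤ w.δm ∧ gm * (w.ux - P.vd) ≤ -γ (attractionErr xd (x i)) + w.δm) ∧
    ∀ j ∈ neighbors P.R x i, 0 ≤ w.δ j ∧
      deriv (collisionErr P.r P.ρ (x j)) (x i) * (w.ux - P.vd)
        ≤ -γ (collisionErr P.r P.ρ (x j) (x i)) + w.δ j}

noncomputable def lonCost {N : ℕ} (P : Params) (x : Fin N → ℝ) (i : Fin N) (w : LonDecision N) :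
    ℝ :=
  (w.ux - P.vd) ^ 2 + P.c * (w.δm ^ 2 + ∑ j ∈ neighbors P.R x i, w.δ j ^ 2)

/-- All three groups of constraints of the merging problem of vehicle `i`. -/
def feasible {N : ℕ} (P : Params) (γ : ℝ → ℝ) (xd : ℝ) (x : Fin N → ℝ) (y : ℝ) (i : Fin N)
    (gc gm : ℝ) : Set (Decision N) :=
  {w | w.toLatDecision ∈ latFeasible P γ y gc ∧ w.toLonDecision ∈ lonFeasible P γ xd x i gm}

noncomputable def cost {N : ℕ} (P : Params) (x : Fin N → ℝ) (i : Fin N) (w : Decision N) : ℝ :=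
  (w.ux - P.vd) ^ 2 + w.uy ^ 2
    + P.c * (w.δm ^ 2 + w.δc ^ 2 + ∑ j ∈ neighbors P.R x i, w.δ j ^ 2)

/-- `w` is an optimal solution of: minimise `f` over `S`. -/
def IsOptimal {α : Type} (S : Set α) (f : α → ℝ) (w : α) : Prop := w ∈ S ∧ IsMinOn f S w

/-- Longitudinal and lateral coordinates (or velocities) of all vehicles. -/
abbrev State (N : ℕ) : Type := (Fin N → ℝ) × (Fin N → ℝ)

/-- The feedback law: all inputs `u = (ux, uy)` such that, for every vehicle `i`, `ux i` and `uy i`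
are the first components of an optimal solution of its merging problem at the positions `p`. -/
def optimalInputs {N : ℕ} (P : Params) (γ : ℝ → ℝ) (xd : ℝ) (p : State N) : Set (State N) :=
  {u | ∀ i, ∃ (gc gm : ℝ) (w : Decision N),
    IsSubgradient (lateralErr P.yd) (p.2 i) gc ∧
    IsSubgradient (attractionErr xd) (p.1 i) gm ∧
    IsOptimal (feasible P γ xd p.1 (p.2 i) i gc gm) (cost P p.1 i) w ∧
    u.1 i = w.ux ∧ u.2 i = w.uy}

/-- Krasovskii regularization of the feedback law. The law is discontinuous in `p` (constraints
appear and disappear when `|x i - x j|` crosses `R`, and the slope of the attraction error jumps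
at `xd`), and sliding along `|x i - x j| = R` does occur, so that solutions in the plain sense need
not exist. -/
def regularizedInputs {N : ℕ} (P : Params) (γ : ℝ → ℝ) (xd : ℝ) (p : State N) : Set (State N) :=
  ⋂ (ε : ℝ) (_ : 0 < ε), closure (convexHull ℝ (⋃ q ∈ Metric.ball p ε, optimalInputs P γ xd q))

/-- The optimal inputs themselves are admitted, so every trajectory with `x' = ux`, `y' = uy` for
optimal inputs `ux`, `uy` is a trajectory in the sense below. -/
theorem optimalInputs_subset {N : ℕ} (P : Params) (γ : ℝ → ℝ) (xd : ℝ) (p : State N) :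
    optimalInputs P γ xd p ⊆ regularizedInputs P γ xd p := by
  intro u hu
  refine Set.mem_iInter₂.2 fun ε hε => subset_closure (subset_convexHull ℝ _ ?_)
  exact Set.mem_biUnion (Metric.mem_ball_self hε) hu

/-- The vehicles `(x i, y i)` move from time `T₁` on by `x' = ux`, `y' = uy` under the feedback law:
the positions are locally absolutely continuous, and at almost every time their derivatives exist
and belong to the (regularized) feedback law at the current positions. -/
structure IsClosedLoop {N : ℕ} (P : Params) (γ : ℝ → ℝ) (T₁ : ℝ) (xd : ℝ → ℝ)
    (x y : Fin N → ℝ → ℝ) : Prop where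
  ac_x : ∀ i, ∀ T, T₁ ≤ T → AbsolutelyContinuousOnInterval (x i) T₁ T
  ac_y : ∀ i, ∀ T, T₁ ≤ T → AbsolutelyContinuousOnInterval (y i) T₁ T
  dynamics : ∀ᵐ t, T₁ < t → ∃ u ∈ regularizedInputs P γ (xd t) (fun i => x i t, fun i => y i t),
    ∀ i, HasDerivAt (x i) (u.1 i) t ∧ HasDerivAt (y i) (u.2 i) t

end Platoon

/-!
In the frame of the virtual target put `z i = x i - xd`. Eliminating the slacks, the longitudinal
problem of vehicle `i` asks for the minimum over `v = ux - vd` of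
`v ^ 2 + c * ∑ k, max 0 (a k + b k * v) ^ 2`, where the `a k` are the errors and the `b k` their
slopes. As `max 0` is monotone and `1`-Lipschitz, the first-order condition says that
`v = -κ * ∑ k, b k * max 0 (a k)` with a gain `κ` between `c / (1 + c * ∑ k, b k ^ 2)` and `c`
(`exists_gain_of_isMin_softCost`). The sum `∑ k, b k * max 0 (a k)` is the `i`-th partial derivative
of a potential: half the squared distance to the target plus, for every pair of vehicles, half the
square of the positive part of the collision-avoidance error. Vehicles farther apart than `ρ` do not
contribute to it. Hence the discontinuities of the feedback law, at the sensing radius and at the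
target, affect only the gain, and the bounds `-κ * gradient`, being continuous in the positions,
hold for Krasovskii solutions too (`lon_velocity_of_mem_regularizedInputs`). The lateral law is
treated in the same way.

The potential is therefore a Lyapunov function. It blows up when a gap approaches `r`, so the gaps
stay bounded away from `r` and the order of the vehicles is preserved
(`IsGainFlow.exists_add_le_gap`, `IsGainFlow.orderCell`). On the convex set of positions with a
given order the potential is strongly convex (`potential_add_le`) and attains its minimum. Along the
flow its derivative is at most `-2 * k` times its excess over the minimum, for some `k > 0`, so the
positions converge to the minimizer (`IsGainFlow.exists_tendsto`), and the velocities, bounded by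
`c` times the gradient, converge to that of the target. At the minimizer two consecutive vehicles
are closer than `ρ`: otherwise the vehicles ahead of the gap and those behind it do not interact, each
group has its barycentre at the target, and this contradicts their order (`sub_lt_of_critical`).
-/

namespace Platoon

/-! ### Splitting of the merging problem -/

/-- Cost and constraints of the merging problem are a sum and a product of those of its parts. -/
theorem isOptimal_iff_lat_lon {N : ℕ} (P : Params) (γ : ℝ → ℝ) (xd : ℝ) (x : Fin N → ℝ) (y : ℝ)
    (i : Fin N) (gc gm : ℝ) (w : Decision N) :
    IsOptimal (feasible P γ xd x y i gc gm) (cost P x i) w ↔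
      IsOptimal (latFeasible P γ y gc) (latCost P) w.toLatDecision ∧
        IsOptimal (lonFeasible P γ xd x i gm) (lonCost P x i) w.toLonDecision := by
  have hcost : ∀ w : Decision N,
      cost P x i w = latCost P w.toLatDecision + lonCost P x i w.toLonDecision := by
    intro w
    simp only [cost, latCost, lonCost]
    ring
  constructor
  · rintro ⟨⟨h1, h2⟩, hmin⟩
    refine ⟨⟨h1, fun a ha => ?_⟩, ⟨h2, fun b hb => ?_⟩⟩
    · have h := hmin (show (⟨a, w.toLonDecision⟩ : Decision N) ∈ _ from ⟨ha, h2⟩)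
      simp only [Set.mem_ofPred_eq, hcost] at h ⊢
      linarith
    · have h := hmin (show (⟨w.toLatDecision, b⟩ : Decision N) ∈ _ from ⟨h1, hb⟩)
      simp only [Set.mem_ofPred_eq, hcost] at h ⊢
      linarith
  · rintro ⟨⟨h1, hm1⟩, ⟨h2, hm2⟩⟩
    refine ⟨⟨h1, h2⟩, fun b hb => ?_⟩
    have ha := hm1 hb.1
    have hb := hm2 hb.2
    simp only [Set.mem_ofPred_eq, hcost] at ha hb ⊢
    linarith

/-! ### Minimizers of soft-constrained quadratic programs in one variable -/

theorem hasDerivAt_max_zero_sq (s : ℝ) :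
    HasDerivAt (fun s : ℝ => max 0 s ^ 2) (2 * max 0 s) s := by
  have hne : ∀ s : ℝ, s ≠ 0 → HasDerivAt (fun s : ℝ => max 0 s ^ 2) (2 * max 0 s) s := by
    intro s hs
    rcases lt_or_gt_of_ne hs with h | h
    · rw [max_eq_left h.le, mul_zero]
      refine (hasDerivAt_const s (0 : ℝ)).congr_of_eventuallyEq ?_
      filter_upwards [eventually_lt_nhds h] with u hu
      simp [max_eq_left hu.le]
    · rw [max_eq_right h.le]
      have h2 : HasDerivAt (fun s : ℝ => s ^ 2) (2 * s) s := by simpa using hasDerivAt_pow 2 s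
      refine h2.congr_of_eventuallyEq ?_
      filter_upwards [eventually_gt_nhds h] with u hu
      simp [max_eq_right hu.le]
  rcases eq_or_ne s 0 with rfl | hs
  · exact hasDerivAt_of_hasDerivAt_of_ne (g := fun s : ℝ => 2 * max 0 s) (fun y hy => hne y hy)
      (by fun_prop) (by fun_prop)
  · exact hne s hs

theorem exists_max_zero_add_eq (a h : ℝ) :
    ∃ θ, 0 ≤ θ ∧ θ ≤ 1 ∧ max 0 (a + h) = max 0 a + θ * h := by
  rcases lt_trichotomy h 0 with hh | rfl | hh
  · refine ⟨(max 0 a - max 0 (a + h)) / (-h), ?_, ?_, ?_⟩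
    · exact div_nonneg (sub_nonneg.2 (max_le_max le_rfl (by linarith))) (by linarith)
    · rw [div_le_one (by linarith)]
      grind
    · have := hh.ne
      field_simp
      ring
  · exact ⟨0, le_rfl, zero_le_one, by simp⟩
  · refine ⟨(max 0 (a + h) - max 0 a) / h, ?_, ?_, ?_⟩
    · exact div_nonneg (sub_nonneg.2 (max_le_max le_rfl (by linarith))) hh.le
    · rw [div_le_one hh]
      grind
    · field_simp
      ring

/-- Cost of the input `v` once every constraint `b k * v ≤ -a k + δ k`, `0 ≤ δ k` is relaxed by
its smallest admissible slack `δ k = max 0 (a k + b k * v)`. -/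
def softCost {ι : Type*} (c : ℝ) (S : Finset ι) (a b : ι → ℝ) (v : ℝ) : ℝ :=
  v ^ 2 + c * ∑ k ∈ S, max 0 (a k + b k * v) ^ 2

/-- The minimizer is a negative multiple of the derivative of the cost at `v = 0`, and the
multiple is bounded above and below independently of the signs of the `a k`. The reason is that
`t ↦ max 0 t` is monotone with slopes at most `1`. -/
theorem exists_gain_of_isMin_softCost {ι : Type*} {c : ℝ} (hc : 0 < c) (S : Finset ι)
    (a b : ι → ℝ) {v : ℝ} (hv : ∀ v', softCost c S a b v ≤ softCost c S a b v') :
    ∃ κ, c / (1 + c * ∑ k ∈ S, b k ^ 2) ≤ κ ∧ κ ≤ c ∧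
      v = -κ * ∑ k ∈ S, b k * max 0 (a k) := by
  have hder : HasDerivAt (softCost c S a b)
      (2 * v + c * ∑ k ∈ S, 2 * max 0 (a k + b k * v) * b k) v := by
    have h1 : HasDerivAt (fun v : ℝ => v ^ 2) (2 * v) v := by simpa using hasDerivAt_pow 2 v
    refine h1.add (HasDerivAt.const_mul c (HasDerivAt.fun_sum fun k _ => ?_))
    have h2 : HasDerivAt (fun v : ℝ => a k + b k * v) (b k) v := by
      simpa using ((hasDerivAt_id v).const_mul (b k)).const_add (a k)
    exact (hasDerivAt_max_zero_sq _).comp v h2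
  have hzero := IsLocalMin.hasDerivAt_eq_zero (Eventually.of_forall hv) hder
  choose θ hθ0 hθ1 hθ using fun k => exists_max_zero_add_eq (a k) (b k * v)
  set A := ∑ k ∈ S, b k * max 0 (a k) with hA
  set B := ∑ k ∈ S, θ k * b k ^ 2 with hB
  have hB0 : 0 ≤ B := Finset.sum_nonneg fun k _ => mul_nonneg (hθ0 k) (sq_nonneg _)
  have hB1 : B ≤ ∑ k ∈ S, b k ^ 2 :=
    Finset.sum_le_sum fun k _ => mul_le_of_le_one_left (sq_nonneg _) (hθ1 k)
  have hsum : ∑ k ∈ S, 2 * max 0 (a k + b k * v) * b k = 2 * A + 2 * B * v := by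
    rw [hA, hB, Finset.mul_sum, Finset.mul_sum, Finset.sum_mul, ← Finset.sum_add_distrib]
    refine Finset.sum_congr rfl fun k _ => ?_
    rw [hθ k]
    ring
  rw [hsum] at hzero
  have hpos : 0 < 1 + c * B := by positivity
  refine ⟨c / (1 + c * B), ?_, ?_, ?_⟩
  · exact div_le_div_of_nonneg_left hc.le hpos (by gcongr)
  · exact div_le_self hc.le (by nlinarith)
  · field_simp
    linarith

/-- If `v` and slacks `δ` are feasible and cost no more than any input `v'` with its smallest
slacks, then `v` minimizes the relaxed cost. -/
theorem softCost_le_of_slack {ι : Type*} {c : ℝ} (hc : 0 < c) (S : Finset ι)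
    (a b δ : ι → ℝ) {v : ℝ} (h0 : ∀ k ∈ S, 0 ≤ δ k) (h1 : ∀ k ∈ S, b k * v ≤ -a k + δ k)
    (hopt : ∀ v', v ^ 2 + c * ∑ k ∈ S, δ k ^ 2 ≤ softCost c S a b v') (v' : ℝ) :
    softCost c S a b v ≤ softCost c S a b v' := by
  refine le_trans ?_ (hopt v')
  unfold softCost
  gcongr with k hk
  exact max_le (h0 k hk) (by linarith [h1 k hk])

/-- The product of error and slope is `p - a` whichever subgradient is chosen at the kink, because
the error vanishes there. -/
theorem IsSubgradient.abs_sub {a p g : ℝ} (h : IsSubgradient (fun σ => |σ - a|) p g) :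
    |g| ≤ 1 ∧ g * |p - a| = p - a := by
  have h1 := h (p + 1)
  have h2 := h (p - 1)
  have h3 := h a
  have h4 := h (2 * p - a)
  simp only [sub_self, abs_zero] at h1 h2 h3 h4
  have e1 : |p + 1 - a| ≤ |p - a| + 1 := by
    rw [show p + 1 - a = (p - a) + 1 by ring]
    simpa using abs_add_le (p - a) 1
  have e2 : |p - 1 - a| ≤ |p - a| + 1 := by
    rw [show p - 1 - a = (p - a) + -1 by ring]
    simpa using abs_add_le (p - a) (-1)
  have e4 : |2 * p - a - a| = 2 * |p - a| := by
    rw [show 2 * p - a - a = 2 * (p - a) by ring, abs_mul]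
    norm_num
  rw [e4] at h4
  have h5 : |p - a| = g * (p - a) := by linarith
  refine ⟨abs_le.2 ⟨by linarith, by linarith⟩, ?_⟩
  rcases eq_or_ne (p - a) 0 with h0 | h0
  · simp [h0]
  · have h6 : |g| = 1 := by
      have := congrArg abs h5
      rw [abs_abs, abs_mul] at this
      exact mul_right_cancel₀ (abs_ne_zero.2 h0) (by linarith)
    have h7 : g * g = 1 := by rw [← abs_mul_abs_self, h6, one_mul]
    rw [h5, ← mul_assoc, h7, one_mul]

/-! ### The feedback law as a gradient flow with bounded gains -/

/-- Positive part of the collision-avoidance error of two vehicles at longitudinal offset `u`.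
It vanishes for `|u| ≥ ρ`, and also for `|u| ≤ r`, where `1 / (|u| - r)` is not positive. -/
noncomputable def pairErr (r ρ u : ℝ) : ℝ := max 0 (1 / (|u| - r) - 1 / (ρ - r))

/-- Slope of the collision-avoidance error at offset `u`, for `|u| > r`. At `u = 0` it is `0`, so
that the diagonal terms in sums over all pairs of vehicles vanish. -/
noncomputable def pairSlope (r u : ℝ) : ℝ := -(SignType.sign u : ℝ) / (|u| - r) ^ 2

/-- Potential of the longitudinal offsets `z` from the virtual target: attraction to `0` and
repulsion of the vehicles closer than `ρ`. The denominator is `4` because the double sum counts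
every pair twice. -/
noncomputable def potential {N : ℕ} (r ρ : ℝ) (z : Fin N → ℝ) : ℝ :=
  (∑ i, z i ^ 2) / 2 + (∑ i, ∑ j, pairErr r ρ (z i - z j) ^ 2) / 4

/-- Partial derivatives of the potential. -/
noncomputable def potentialGrad {N : ℕ} (r ρ : ℝ) (z : Fin N → ℝ) (i : Fin N) : ℝ :=
  z i + ∑ j, pairSlope r (z i - z j) * pairErr r ρ (z i - z j)

/-- Sum of the squared slopes of the collision-avoidance errors of vehicle `i`. -/
noncomputable def stiffness {N : ℕ} (r : ℝ) (z : Fin N → ℝ) (i : Fin N) : ℝ :=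
  ∑ j, pairSlope r (z i - z j) ^ 2

/-- Lower bound of the gain with which vehicle `i` follows the negative gradient. -/
noncomputable def minGain {N : ℕ} (r c : ℝ) (z : Fin N → ℝ) (i : Fin N) : ℝ :=
  c / (1 + c * (1 + stiffness r z i))

/-- All pairs of vehicles are more than `r` apart. -/
def Separated {N : ℕ} (r : ℝ) (z : Fin N → ℝ) : Prop := ∀ i j, i ≠ j → r < |z i - z j|

@[simp] theorem pairSlope_zero (r : ℝ) : pairSlope r 0 = 0 := by simp [pairSlope]

theorem hasDerivAt_one_div_abs_sub {r u : ℝ} (hr : 0 < r) (hu : r < |u|) :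
    HasDerivAt (fun u : ℝ => 1 / (|u| - r)) (pairSlope r u) u := by
  have h0 : u ≠ 0 := abs_pos.1 (hr.trans hu)
  have h := ((hasDerivAt_abs h0).sub_const r).inv (sub_pos.2 hu).ne'
  simpa [pairSlope, one_div] using! h

theorem deriv_collisionErr {r ρ a σ : ℝ} (hr : 0 < r) (h : r < |σ - a|) :
    deriv (collisionErr r ρ a) σ = pairSlope r (σ - a) := by
  have h1 := (hasDerivAt_one_div_abs_sub hr h).comp σ ((hasDerivAt_id σ).sub_const a)
  have h2 := h1.sub_const (1 / (ρ - r))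
  rw [mul_one] at h2
  exact h2.deriv

theorem pairErr_eq_zero {r ρ u : ℝ} (hrρ : r < ρ) (hu : ρ ≤ |u|) : pairErr r ρ u = 0 := by
  have h1 : 1 / (|u| - r) ≤ 1 / (ρ - r) :=
    one_div_le_one_div_of_le (by linarith) (by linarith)
  exact max_eq_left (by linarith)

theorem minGain_pos {N : ℕ} {r c : ℝ} (hc : 0 < c) (z : Fin N → ℝ) (i : Fin N) :
    0 < minGain r c z i := by
  have : 0 ≤ stiffness r z i := Finset.sum_nonneg fun j _ => sq_nonneg _
  unfold minGain
  positivity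

theorem minGain_le {N : ℕ} {r c : ℝ} (hc : 0 < c) (z : Fin N → ℝ) (i : Fin N) :
    minGain r c z i ≤ c := by
  have : 0 ≤ stiffness r z i := Finset.sum_nonneg fun j _ => sq_nonneg _
  exact div_le_self hc.le (by nlinarith [mul_nonneg hc.le this])

/-- Optimal lateral inputs: a proportional feedback with gain between `c / (1 + c)` and `c`. -/
theorem exists_gain_of_isOptimal_lat {P : Params} (hc : 0 < P.c) {y gc : ℝ}
    (hg : IsSubgradient (lateralErr P.yd) y gc) {w : LatDecision}
    (hw : IsOptimal (latFeasible P (fun φ => φ) y gc) (latCost P) w) :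
    ∃ κ, P.c / (1 + P.c) ≤ κ ∧ κ ≤ P.c ∧ w.uy = -κ * (y - P.yd) := by
  obtain ⟨⟨h0, h1⟩, hmin⟩ := hw
  obtain ⟨hg1, hg2⟩ := IsSubgradient.abs_sub hg
  have h0' : (0 : ℝ) ≤ |y - P.yd| := abs_nonneg _
  obtain ⟨κ, hκ1, hκ2, hκ⟩ := exists_gain_of_isMin_softCost hc (Finset.univ : Finset Unit)
    (fun _ => |y - P.yd|) (fun _ => gc) (v := w.uy)
    (softCost_le_of_slack hc _ _ _ (fun _ => w.δc) (fun _ _ => h0) (fun _ _ => h1) (by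
      intro v'
      have h := hmin (show (⟨v', max 0 (|y - P.yd| + gc * v')⟩ : LatDecision) ∈ _ from
        ⟨le_max_left _ _, by
          have := le_max_right 0 (|y - P.yd| + gc * v')
          simp only [lateralErr]
          linarith⟩)
      simpa [latCost, softCost] using h))
  have hgc : gc ^ 2 ≤ 1 := (sq_le_one_iff_abs_le_one _).2 hg1
  refine ⟨κ, le_trans ?_ hκ1, hκ2, ?_⟩
  · rw [Fintype.sum_unique]
    exact div_le_div_of_nonneg_left hc.le (by positivity) (by nlinarith)
  · rw [hκ, Fintype.sum_unique, max_eq_right h0', hg2]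

/-- Optimal longitudinal inputs, relative to the target, are a bounded negative multiple of the
gradient of the potential. Neighbours farther away than `ρ` have a negative error, hence do not
enter the gradient: the discontinuity at the sensing radius affects the gain only. -/
theorem exists_gain_of_isOptimal_lon {N : ℕ} {P : Params} (hr : 0 < P.r) (hrρ : P.r < P.ρ)
    (hρR : P.ρ < P.R) (hc : 0 < P.c) {xd : ℝ} {x : Fin N → ℝ} (hx : Separated P.r x) {i : Fin N}
    {gm : ℝ} (hg : IsSubgradient (attractionErr xd) (x i) gm) {w : LonDecision N}
    (hw : IsOptimal (lonFeasible P (fun φ => φ) xd x i gm) (lonCost P x i) w) :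
    ∃ κ, minGain P.r P.c (fun k => x k - xd) i ≤ κ ∧ κ ≤ P.c ∧
      w.ux - P.vd = -κ * potentialGrad P.r P.ρ (fun k => x k - xd) i := by
  obtain ⟨⟨⟨h0, h1⟩, h2⟩, hmin⟩ := hw
  obtain ⟨hg1, hg2⟩ := IsSubgradient.abs_sub hg
  have hder : ∀ j ∈ neighbors P.R x i,
      deriv (collisionErr P.r P.ρ (x j)) (x i) = pairSlope P.r (x i - x j) := by
    intro j hj
    simp only [neighbors, Finset.mem_filter, Finset.mem_univ, true_and] at hj
    exact deriv_collisionErr hr (hx i j hj.1.symm)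
  let a : Option (Fin N) → ℝ := fun k => k.elim |x i - xd| fun j => collisionErr P.r P.ρ (x j) (x i)
  let b : Option (Fin N) → ℝ := fun k => k.elim gm fun j => pairSlope P.r (x i - x j)
  let δ : Option (Fin N) → ℝ := fun k => k.elim w.δm w.δ
  obtain ⟨κ, hκ1, hκ2, hκ⟩ := exists_gain_of_isMin_softCost hc
    (Finset.insertNone (neighbors P.R x i)) a b (v := w.ux - P.vd)
    (softCost_le_of_slack hc _ _ _ δ
      (by
        rintro (_ | j) hj
        · exact h0
        · exact (h2 j (Finset.some_mem_insertNone.1 hj)).1)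
      (by
        rintro (_ | j) hj
        · exact h1
        · have hj := Finset.some_mem_insertNone.1 hj
          have := (h2 j hj).2
          rw [hder j hj] at this
          exact this)
      (by
        intro v'
        have h := hmin (show (⟨v' + P.vd, max 0 (a none + b none * v'),
            fun j => max 0 (a (some j) + b (some j) * v')⟩ : LonDecision N) ∈ _ from
          ⟨⟨le_max_left _ _, by
            have := le_max_right 0 (a none + b none * v')
            simp only [attractionErr, add_sub_cancel_right, a, b, Option.elim] at this ⊢
            linarith⟩, fun j hj => ⟨le_max_left _ _, by
            have := le_max_right 0 (a (some j) + b (some j) * v')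
            rw [hder j hj]
            simp only [add_sub_cancel_right, a, b, Option.elim] at this ⊢
            linarith⟩⟩)
        simpa [lonCost, softCost, Finset.sum_insertNone, δ] using h))
  rw [Finset.sum_insertNone] at hκ1 hκ
  have hgm : gm ^ 2 ≤ 1 := (sq_le_one_iff_abs_le_one _).2 hg1
  refine ⟨κ, le_trans ?_ hκ1, hκ2, ?_⟩
  · have hle : ∑ j ∈ neighbors P.R x i, b (some j) ^ 2 ≤
        stiffness P.r (fun k => x k - xd) i := by
      unfold stiffness
      simp only [sub_sub_sub_cancel_right]
      exact Finset.sum_le_univ_sum_of_nonneg fun j => sq_nonneg _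
    have hb : 0 ≤ ∑ j ∈ neighbors P.R x i, b (some j) ^ 2 :=
      Finset.sum_nonneg fun j _ => sq_nonneg _
    refine div_le_div_of_nonneg_left hc.le (by positivity) ?_
    have : b none ^ 2 ≤ 1 := hgm
    gcongr
  · rw [hκ]
    congr 1
    unfold potentialGrad
    simp only [sub_sub_sub_cancel_right]
    congr 1
    · simp only [a, b, Option.elim]
      rw [max_eq_right (abs_nonneg _), hg2]
    · simp only [a, b, Option.elim]
      refine Finset.sum_subset_zero_on_sdiff (Finset.subset_univ _) ?_ (fun j _ => rfl)
      intro j hj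
      simp only [neighbors, Finset.mem_sdiff, Finset.mem_filter, Finset.mem_univ, true_and,
        not_and, not_le] at hj
      rcases eq_or_ne j i with rfl | hji
      · simp
      · rw [pairErr_eq_zero hrρ (hρR.trans (hj hji)).le, mul_zero]

/-! ### The regularized feedback law -/

/-- A lower bound of a linear functional on the feedback law that is continuous in the positions
survives the Krasovskii regularization. -/
theorem le_of_mem_regularizedInputs {N : ℕ} {P : Params} {γ : ℝ → ℝ} {xd : ℝ} {p u : State N}
    (hu : u ∈ regularizedInputs P γ xd p) (L : State N →L[ℝ] ℝ) {lo : State N → ℝ}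
    (hlo : ContinuousAt lo p)
    (h : ∀ᶠ q in 𝓝 p, ∀ u ∈ optimalInputs P γ xd q, lo q ≤ L u) : lo p ≤ L u := by
  refine le_of_forall_lt fun b hb => ?_
  obtain ⟨b', hb', hb''⟩ := exists_between hb
  have hev : ∀ᶠ q in 𝓝 p, ∀ u ∈ optimalInputs P γ xd q, b' ≤ L u := by
    filter_upwards [h, hlo.eventually_const_lt hb''] with q h1 h2 u hu
    exact h2.le.trans (h1 u hu)
  obtain ⟨ε, hε, hball⟩ := Metric.eventually_nhds_iff_ball.1 hev
  have hmem := Set.mem_iInter₂.1 hu ε hε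
  have hsub : closure (convexHull ℝ (⋃ q ∈ Metric.ball p ε, optimalInputs P γ xd q)) ⊆
      {u | b' ≤ L u} := by
    refine closure_minimal (convexHull_min ?_ ?_) (isClosed_le continuous_const L.continuous)
    · intro u hu
      obtain ⟨q, hq, hu⟩ := Set.mem_iUnion₂.1 hu
      exact hball q hq u hu
    · exact convex_halfSpace_ge L.toLinearMap.isLinear b'
  exact hb'.trans_le (hsub hmem)

/-- Two-sided bounds by multiples of a continuous function survive the regularization. -/
theorem exists_gain_of_mem_regularizedInputs {N : ℕ} {P : Params} {γ : ℝ → ℝ} {xd : ℝ}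
    {p u : State N} (hu : u ∈ regularizedInputs P γ xd p) (L : State N →L[ℝ] ℝ) (v c : ℝ)
    {g k : State N → ℝ} (hg : ContinuousAt g p) (hk : ContinuousAt k p)
    (h : ∀ᶠ q in 𝓝 p, ∀ u ∈ optimalInputs P γ xd q,
      ∃ κ, k q ≤ κ ∧ κ ≤ c ∧ L u - v = -κ * g q) (hkc : k p ≤ c) :
    ∃ κ, k p ≤ κ ∧ κ ≤ c ∧ L u - v = -κ * g p := by
  have key : ∀ {κ k c g : ℝ}, k ≤ κ → κ ≤ c →
      min (k * g) (c * g) ≤ κ * g ∧ κ * g ≤ max (k * g) (c * g) := by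
    intro κ k c g h1 h2
    rcases le_total 0 g with hg | hg
    · exact ⟨min_le_of_left_le (by gcongr), le_max_of_le_right (by gcongr)⟩
    · exact ⟨min_le_of_right_le (mul_le_mul_of_nonpos_right h2 hg),
        le_max_of_le_left (mul_le_mul_of_nonpos_right h1 hg)⟩
  have h1 := le_of_mem_regularizedInputs hu L
    (lo := fun q => v - max (k q * g q) (c * g q)) (by fun_prop) (by
      filter_upwards [h] with q hq u hu
      obtain ⟨κ, a1, a2, a3⟩ := hq u hu
      have := (key (g := g q) a1 a2).2
      linarith)
  have h2 := le_of_mem_regularizedInputs hu (-L)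
    (lo := fun q => min (k q * g q) (c * g q) - v) (by fun_prop) (by
      filter_upwards [h] with q hq u hu
      obtain ⟨κ, a1, a2, a3⟩ := hq u hu
      have := (key (g := g q) a1 a2).1
      simp only [neg_apply]
      linarith)
  simp only [neg_apply] at h2
  rcases lt_trichotomy (g p) 0 with hg0 | hg0 | hg0
  · have e : k p * g p ≥ c * g p := mul_le_mul_of_nonpos_right hkc hg0.le
    rw [max_eq_left e] at h1
    rw [min_eq_right e] at h2
    refine ⟨-(L u - v) / g p, ?_, ?_, ?_⟩
    · rw [le_div_iff_of_neg hg0]; linarith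
    · rw [div_le_iff_of_neg hg0]; linarith
    · field_simp [hg0.ne]
  · rw [hg0] at h1 h2 ⊢
    simp only [mul_zero, max_self, min_self] at h1 h2
    exact ⟨c, hkc, le_rfl, by linarith⟩
  · have e : k p * g p ≤ c * g p := mul_le_mul_of_nonneg_right hkc hg0.le
    rw [max_eq_right e] at h1
    rw [min_eq_left e] at h2
    refine ⟨-(L u - v) / g p, ?_, ?_, ?_⟩
    · rw [le_div_iff₀ hg0]; linarith
    · rw [div_le_iff₀ hg0]; linarith
    · field_simp

theorem continuousAt_pairSlope {r u : ℝ} (hr : 0 < r) (hu : r < |u|) :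
    ContinuousAt (pairSlope r) u := by
  have h0 : u ≠ 0 := abs_pos.1 (hr.trans hu)
  have hs : ContinuousAt (fun u : ℝ => (SignType.sign u : ℝ)) u := by
    have h1 := continuousAt_sign_of_ne_zero h0
    exact (continuous_of_discreteTopology (f := fun s : SignType => (s : ℝ))).continuousAt.comp h1
  exact hs.neg.div (by fun_prop) (pow_ne_zero 2 (sub_pos.2 hu).ne')

theorem continuousAt_pairErr {r ρ u : ℝ} (hu : r < |u|) : ContinuousAt (pairErr r ρ) u := by
  have : |u| - r ≠ 0 := (sub_pos.2 hu).ne'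
  unfold pairErr
  fun_prop (disch := assumption)

/-- Sums over pairs are continuous at separated positions as soon as the summand is continuous
beyond `r`: the diagonal terms are constant. -/
theorem continuousAt_pair {N : ℕ} {r : ℝ} {f : ℝ → ℝ} (hf : ∀ u, r < |u| → ContinuousAt f u)
    {z : Fin N → ℝ} (hz : Separated r z) (i j : Fin N) :
    ContinuousAt (fun z : Fin N → ℝ => f (z i - z j)) z := by
  rcases eq_or_ne i j with rfl | hij
  · simpa using continuousAt_const
  · exact (hf _ (hz i j hij)).comp (f := fun z : Fin N → ℝ => z i - z j) (by fun_prop)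

theorem continuousAt_potential {N : ℕ} {r ρ : ℝ} {z : Fin N → ℝ} (hz : Separated r z) :
    ContinuousAt (potential r ρ) z := by
  have h := fun i j : Fin N =>
    continuousAt_pair (fun u hu => continuousAt_pairErr (ρ := ρ) hu) hz i j
  refine ContinuousAt.add (ContinuousAt.div_const ?_ 2) (ContinuousAt.div_const ?_ 4)
  · exact tendsto_finsetSum _ fun i _ => (continuous_apply i).continuousAt.pow 2
  · exact tendsto_finsetSum _ fun i _ => tendsto_finsetSum _ fun j _ => (h i j).pow 2

theorem continuousAt_potentialGrad {N : ℕ} {r ρ : ℝ} (hr : 0 < r) {z : Fin N → ℝ}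
    (hz : Separated r z) (i : Fin N) : ContinuousAt (fun z => potentialGrad r ρ z i) z := by
  have h1 := fun j : Fin N =>
    continuousAt_pair (fun u hu => continuousAt_pairErr (ρ := ρ) hu) hz i j
  have h2 := fun j : Fin N => continuousAt_pair (fun u hu => continuousAt_pairSlope hr hu) hz i j
  exact (continuous_apply i).continuousAt.add (tendsto_finsetSum _ fun j _ => (h2 j).mul (h1 j))

theorem continuousAt_minGain {N : ℕ} {r c : ℝ} (hr : 0 < r) (hc : 0 < c) {z : Fin N → ℝ}
    (hz : Separated r z) (i : Fin N) : ContinuousAt (fun z => minGain r c z i) z := by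
  have h2 := fun j : Fin N => continuousAt_pair (fun u hu => continuousAt_pairSlope hr hu) hz i j
  have h3 : 0 ≤ stiffness r z i := Finset.sum_nonneg fun j _ => sq_nonneg _
  have h4 : 1 + c * (1 + stiffness r z i) ≠ 0 := by positivity
  unfold minGain
  have h5 : ContinuousAt (fun z => stiffness r z i) z := by
    unfold stiffness
    fun_prop
  fun_prop (disch := assumption)

theorem isOpen_separated {N : ℕ} (r : ℝ) : IsOpen {z : Fin N → ℝ | Separated r z} := by
  simp only [Separated, Set.ofPred_forall]
  refine isOpen_iInter_of_finite fun i => isOpen_iInter_of_finite fun j =>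
    isOpen_iInter_of_finite fun _ => isOpen_lt (by fun_prop) (by fun_prop)

theorem Separated.sub_const {N : ℕ} {r : ℝ} {z : Fin N → ℝ} (hz : Separated r z) (a : ℝ) :
    Separated r (fun i => z i - a) := by
  intro i j hij
  simpa using hz i j hij

theorem lat_velocity_of_mem_regularizedInputs {N : ℕ} {P : Params} (hc : 0 < P.c) {xd : ℝ}
    {p u : State N} (hu : u ∈ regularizedInputs P (fun φ => φ) xd p) (i : Fin N) :
    ∃ κ, P.c / (1 + P.c) ≤ κ ∧ κ ≤ P.c ∧ u.2 i = -κ * (p.2 i - P.yd) := by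
  have h := exists_gain_of_mem_regularizedInputs hu
    ((ContinuousLinearMap.proj i).comp (ContinuousLinearMap.snd ℝ (Fin N → ℝ) (Fin N → ℝ))) 0 P.c
    (g := fun q => q.2 i - P.yd) (k := fun _ => P.c / (1 + P.c)) (by fun_prop) (by fun_prop)
    (Eventually.of_forall fun q u hu => by
      obtain ⟨gc, gm, w, hgc, -, hw, -, huw⟩ := hu i
      obtain ⟨κ, h1, h2, h3⟩ :=
        exists_gain_of_isOptimal_lat hc hgc ((isOptimal_iff_lat_lon _ _ _ _ _ _ _ _ _).1 hw).1
      exact ⟨κ, h1, h2, by simpa [huw] using h3⟩)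
    (div_le_self hc.le (by linarith))
  simpa using h

theorem lon_velocity_of_mem_regularizedInputs {N : ℕ} {P : Params} (hr : 0 < P.r)
    (hrρ : P.r < P.ρ) (hρR : P.ρ < P.R) (hc : 0 < P.c) {xd : ℝ} {p u : State N}
    (hp : Separated P.r p.1) (hu : u ∈ regularizedInputs P (fun φ => φ) xd p) (i : Fin N) :
    ∃ κ, minGain P.r P.c (fun k => p.1 k - xd) i ≤ κ ∧ κ ≤ P.c ∧
      u.1 i - P.vd = -κ * potentialGrad P.r P.ρ (fun k => p.1 k - xd) i := by
  have hsub : ContinuousAt (fun q : State N => fun k => q.1 k - xd) p := by fun_prop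
  have hsep := hp.sub_const xd
  have h := exists_gain_of_mem_regularizedInputs hu
    ((ContinuousLinearMap.proj i).comp (ContinuousLinearMap.fst ℝ (Fin N → ℝ) (Fin N → ℝ)))
    P.vd P.c
    (g := fun q => potentialGrad P.r P.ρ (fun k => q.1 k - xd) i)
    (k := fun q => minGain P.r P.c (fun k => q.1 k - xd) i)
    ((continuousAt_potentialGrad hr hsep i).comp (f := fun q : State N => fun k => q.1 k - xd) hsub)
    ((continuousAt_minGain hr hc hsep i).comp (f := fun q : State N => fun k => q.1 k - xd) hsub)
    (by
      have hev : ∀ᶠ q : State N in 𝓝 p, Separated P.r q.1 :=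
        continuous_fst.continuousAt.eventually ((isOpen_separated P.r).mem_nhds hp)
      filter_upwards [hev] with q hq u hu
      obtain ⟨gc, gm, w, -, hgm, hw, huw, -⟩ := hu i
      obtain ⟨κ, h1, h2, h3⟩ := exists_gain_of_isOptimal_lon hr hrρ hρR hc hq hgm
        ((isOptimal_iff_lat_lon _ _ _ _ _ _ _ _ _).1 hw).2
      exact ⟨κ, h1, h2, by simpa [huw] using h3⟩)
    (minGain_le hc _ _)
  simpa using h

/-! ### The potential: derivative, convexity and sublevel sets -/

theorem pairErr_nonneg (r ρ u : ℝ) : 0 ≤ pairErr r ρ u := le_max_left _ _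

/-- Half of the derivative of `pairErr ^ 2` is odd. -/
theorem pairSlope_mul_pairErr_neg (r ρ u : ℝ) :
    pairSlope r (-u) * pairErr r ρ (-u) = -(pairSlope r u * pairErr r ρ u) := by
  simp only [pairSlope, pairErr, abs_neg, Left.sign_neg, SignType.coe_neg]
  ring

theorem hasDerivAt_pairErr_sq {r ρ u : ℝ} (hr : 0 < r) (hu : r < |u|) :
    HasDerivAt (fun u => pairErr r ρ u ^ 2) (2 * (pairSlope r u * pairErr r ρ u)) u := by
  have h := (hasDerivAt_max_zero_sq (1 / (|u| - r) - 1 / (ρ - r))).comp u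
    ((hasDerivAt_one_div_abs_sub hr hu).sub_const (1 / (ρ - r)))
  convert! h using 1
  simp only [pairErr]
  ring

theorem sum_sum_odd_mul_sub {N : ℕ} {f : ℝ → ℝ} (hf : ∀ u, f (-u) = -f u) (z v : Fin N → ℝ) :
    ∑ i, ∑ j, f (z i - z j) * (v i - v j) = 2 * ∑ i, (∑ j, f (z i - z j)) * v i := by
  have h1 : ∑ i, ∑ j, f (z i - z j) * v j = -∑ i, ∑ j, f (z i - z j) * v i := by
    rw [Finset.sum_comm, ← Finset.sum_neg_distrib]
    refine Finset.sum_congr rfl fun i _ => ?_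
    rw [← Finset.sum_neg_distrib]
    refine Finset.sum_congr rfl fun j _ => ?_
    rw [← neg_sub (z i) (z j), hf]
    ring
  simp only [mul_sub, Finset.sum_sub_distrib, h1, Finset.sum_mul]
  ring

theorem sum_potentialGrad_mul {N : ℕ} (r ρ : ℝ) (z v : Fin N → ℝ) :
    ∑ i, potentialGrad r ρ z i * v i = ∑ i, z i * v i +
      (∑ i, ∑ j, pairSlope r (z i - z j) * pairErr r ρ (z i - z j) * (v i - v j)) / 2 := by
  rw [sum_sum_odd_mul_sub (f := fun u => pairSlope r u * pairErr r ρ u)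
    (pairSlope_mul_pairErr_neg r ρ)]
  simp only [potentialGrad, add_mul, Finset.sum_add_distrib]
  ring

theorem hasDerivAt_potential {N : ℕ} {r ρ : ℝ} (hr : 0 < r) {z : ℝ → Fin N → ℝ} {v : Fin N → ℝ}
    {t : ℝ} (hz : ∀ i, HasDerivAt (fun t => z t i) (v i) t) (hsep : Separated r (z t)) :
    HasDerivAt (fun t => potential r ρ (z t)) (∑ i, potentialGrad r ρ (z t) i * v i) t := by
  have h1 : ∀ i j, HasDerivAt (fun t => pairErr r ρ (z t i - z t j) ^ 2)
      (2 * (pairSlope r (z t i - z t j) * pairErr r ρ (z t i - z t j)) * (v i - v j)) t := by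
    intro i j
    rcases eq_or_ne i j with rfl | hij
    · simpa using hasDerivAt_const t (pairErr r ρ 0 ^ 2)
    · exact (hasDerivAt_pairErr_sq hr (hsep i j hij)).comp
        (h₂ := fun u => pairErr r ρ u ^ 2) t ((hz i).sub (hz j))
  have h2 := ((HasDerivAt.fun_sum (u := Finset.univ) fun i _ => (hz i).pow 2).div_const 2).add
    ((HasDerivAt.fun_sum (u := Finset.univ) fun i _ =>
      HasDerivAt.fun_sum (u := Finset.univ) fun j _ => h1 i j).div_const 4)
  convert! h2 using 1
  rw [sum_potentialGrad_mul]
  simp only [Finset.sum_div]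
  congr 1
  · refine Finset.sum_congr rfl fun i _ => ?_
    simp
    ring
  · refine Finset.sum_congr rfl fun i _ => Finset.sum_congr rfl fun j _ => ?_
    ring

/-- `pairErr ^ 2` is convex on `(r, ∞)` and on `(-∞, -r)`. -/
theorem pairErr_sq_add_le {r ρ a b : ℝ} (ha : r < |a|) (hb : r < |b|)
    (hab : (SignType.sign a : ℝ) * (b - a) = |b| - |a|) :
    pairErr r ρ a ^ 2 + 2 * (pairSlope r a * pairErr r ρ a * (b - a)) ≤ pairErr r ρ b ^ 2 := by
  have e : pairSlope r a * pairErr r ρ a * (b - a) =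
      -(pairErr r ρ a * ((|b| - |a|) / (|a| - r) ^ 2)) := by
    rw [← hab]
    simp only [pairSlope]
    ring
  rw [e]
  have hA : 0 < |a| - r := sub_pos.2 ha
  have hB : 0 < |b| - r := sub_pos.2 hb
  rcases (pairErr_nonneg r ρ a).eq_or_lt with h0 | h0
  · rw [← h0]
    simp [sq_nonneg]
  · have h1 : pairErr r ρ a = 1 / (|a| - r) - 1 / (ρ - r) := by
      rcases max_choice 0 (1 / (|a| - r) - 1 / (ρ - r)) with h | h
      · exact absurd h h0.ne'
      · exact h
    have h2 : 1 / (|b| - r) - 1 / (ρ - r) ≤ pairErr r ρ b := le_max_right _ _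
    -- `1 / ·` lies above its tangent at `|a| - r`
    have h3 : 1 / (|a| - r) - (|b| - |a|) / (|a| - r) ^ 2 ≤ 1 / (|b| - r) := by
      have : 1 / (|b| - r) - (1 / (|a| - r) - (|b| - |a|) / (|a| - r) ^ 2) =
          (|b| - |a|) ^ 2 / ((|a| - r) ^ 2 * (|b| - r)) := by
        field_simp
        ring
      have : 0 ≤ (|b| - |a|) ^ 2 / ((|a| - r) ^ 2 * (|b| - r)) := by positivity
      linarith
    nlinarith [sq_nonneg (pairErr r ρ b - pairErr r ρ a), mul_le_mul_of_nonneg_left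
      (show -((|b| - |a|) / (|a| - r) ^ 2) ≤ pairErr r ρ b - pairErr r ρ a by linarith) h0.le]

/-- The convex open set of offsets with all gaps larger than `r` in which the vehicles are ordered
as in `e`. -/
def OrderCell {N : ℕ} (r : ℝ) (e z : Fin N → ℝ) : Prop := ∀ i j, e j < e i → r < z i - z j

theorem OrderCell.separated {N : ℕ} {r : ℝ} {e z : Fin N → ℝ}
    (he : Function.Injective e) (hz : OrderCell r e z) : Separated r z := by
  intro i j hij
  rcases lt_or_gt_of_ne (he.ne hij) with h | h
  · rw [abs_sub_comm]
    exact (hz j i h).trans_le (le_abs_self _)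
  · exact (hz i j h).trans_le (le_abs_self _)

theorem isOpen_orderCell {N : ℕ} (r : ℝ) (e : Fin N → ℝ) : IsOpen {z | OrderCell r e z} := by
  simp only [OrderCell, Set.ofPred_forall]
  exact isOpen_iInter_of_finite fun i => isOpen_iInter_of_finite fun j =>
    isOpen_iInter_of_finite fun _ => isOpen_lt (by fun_prop) (by fun_prop)

/-- The potential is strongly convex on each order cell. -/
theorem potential_add_le {N : ℕ} {r ρ : ℝ} (hr : 0 < r) {e z w : Fin N → ℝ}
    (he : Function.Injective e) (hz : OrderCell r e z) (hw : OrderCell r e w) :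
    potential r ρ z + ∑ i, potentialGrad r ρ z i * (w i - z i) + (∑ i, (w i - z i) ^ 2) / 2 ≤
      potential r ρ w := by
  have hpair : ∀ i j, pairErr r ρ (z i - z j) ^ 2 +
      2 * (pairSlope r (z i - z j) * pairErr r ρ (z i - z j) * ((w i - z i) - (w j - z j))) ≤
        pairErr r ρ (w i - w j) ^ 2 := by
    intro i j
    rw [show (w i - z i) - (w j - z j) = (w i - w j) - (z i - z j) by ring]
    rcases eq_or_ne i j with rfl | hij
    · simp
    · refine pairErr_sq_add_le (hz.separated he i j hij) (hw.separated he i j hij) ?_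
      rcases lt_or_gt_of_ne (he.ne hij) with h | h
      · have h1 := hz j i h
        have h2 := hw j i h
        rw [abs_of_neg (by linarith), abs_of_neg (by linarith), sign_neg (by linarith)]
        simp only [SignType.coe_neg_one]
        ring
      · have h1 := hz i j h
        have h2 := hw i j h
        rw [abs_of_pos (by linarith), abs_of_pos (by linarith), sign_pos (by linarith)]
        simp
  have hsum := Finset.sum_le_sum fun i (_ : i ∈ Finset.univ) =>
    Finset.sum_le_sum fun j (_ : j ∈ Finset.univ) => hpair i j
  simp only [Finset.sum_add_distrib, ← Finset.mul_sum] at hsum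
  have hsq : ∑ i, w i ^ 2 =
      ∑ i, z i ^ 2 + 2 * ∑ i, z i * (w i - z i) + ∑ i, (w i - z i) ^ 2 := by
    rw [Finset.mul_sum, ← Finset.sum_add_distrib, ← Finset.sum_add_distrib]
    exact Finset.sum_congr rfl fun i _ => by ring
  rw [sum_potentialGrad_mul]
  unfold potential
  linarith

theorem sq_le_of_potential_le {N : ℕ} {r ρ V : ℝ} {z : Fin N → ℝ} (h : potential r ρ z ≤ V)
    (i : Fin N) : z i ^ 2 ≤ 2 * V := by
  have h1 : z i ^ 2 ≤ ∑ i, z i ^ 2 :=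
    Finset.single_le_sum (f := fun i => z i ^ 2) (fun j _ => sq_nonneg _) (Finset.mem_univ i)
  have h2 : 0 ≤ ∑ i, ∑ j, pairErr r ρ (z i - z j) ^ 2 := by positivity
  unfold potential at h
  linarith

/-- The repulsion blows up at distance `r`, so gaps are bounded away from `r` on sublevel sets. -/
theorem exists_add_le_abs_sub {N : ℕ} {r ρ : ℝ} (hrρ : r < ρ) (V : ℝ) :
    ∃ η, 0 < η ∧ ∀ z : Fin N → ℝ, Separated r z → potential r ρ z ≤ V →
      ∀ i j, i ≠ j → r + η ≤ |z i - z j| := by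
  have hρ : 0 < ρ - r := sub_pos.2 hrρ
  refine ⟨1 / (√(4 * V) + 1 / (ρ - r)), by positivity, fun z hz hV i j hij => ?_⟩
  have hgap : 0 < |z i - z j| - r := sub_pos.2 (hz i j hij)
  have h1 : pairErr r ρ (z i - z j) ^ 2 ≤ ∑ i, ∑ j, pairErr r ρ (z i - z j) ^ 2 :=
    (Finset.single_le_sum (f := fun j => pairErr r ρ (z i - z j) ^ 2) (fun j _ => sq_nonneg _)
      (Finset.mem_univ j)).trans
    (Finset.single_le_sum (f := fun i => ∑ j, pairErr r ρ (z i - z j) ^ 2)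
      (fun i _ => by positivity) (Finset.mem_univ i))
  have h2 : 0 ≤ ∑ i, z i ^ 2 := by positivity
  have h3 : pairErr r ρ (z i - z j) ≤ √(4 * V) := by
    refine Real.le_sqrt_of_sq_le ?_
    unfold potential at hV
    linarith
  have h4 : 1 / (|z i - z j| - r) ≤ √(4 * V) + 1 / (ρ - r) := by
    have : 1 / (|z i - z j| - r) - 1 / (ρ - r) ≤ pairErr r ρ (z i - z j) := le_max_right _ _
    linarith
  have h5 : 1 / (√(4 * V) + 1 / (ρ - r)) ≤ |z i - z j| - r := by
    rw [div_le_iff₀ hgap] at h4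
    rw [div_le_iff₀ (by positivity)]
    linarith
  linarith

theorem exists_le_minGain {N : ℕ} {r c η : ℝ} (hc : 0 < c) (hη : 0 < η) :
    ∃ k, 0 < k ∧ ∀ z : Fin N → ℝ, (∀ i j, i ≠ j → r + η ≤ |z i - z j|) →
      ∀ i, k ≤ minGain r c z i := by
  refine ⟨c / (1 + c * (1 + N * (1 / η ^ 4))), by positivity, fun z hz i => ?_⟩
  have h0 : 0 ≤ stiffness r z i := Finset.sum_nonneg fun j _ => sq_nonneg _
  have h1 : stiffness r z i ≤ N * (1 / η ^ 4) := by
    have : ∀ j ∈ Finset.univ, pairSlope r (z i - z j) ^ 2 ≤ 1 / η ^ 4 := by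
      intro j _
      rcases eq_or_ne i j with rfl | hij
      · rw [sub_self, pairSlope_zero, zero_pow two_ne_zero]
        positivity
      · have h2 : η ≤ |z i - z j| - r := by linarith [hz i j hij]
        have h3 : (-(SignType.sign (z i - z j) : ℝ)) ^ 2 ≤ 1 := by
          rcases SignType.sign (z i - z j) <;> simp
        unfold pairSlope
        rw [div_pow, ← pow_mul]
        gcongr
    simpa [stiffness] using Finset.sum_le_sum this
  unfold minGain
  gcongr

/-! ### The equilibrium -/

/-- Sublevel sets of the potential in an order cell are compact, so a minimizer exists. -/
theorem exists_isMin_potential {N : ℕ} {r ρ : ℝ} (hr : 0 < r) (hrρ : r < ρ) {e z₀ : Fin N → ℝ}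
    (he : Function.Injective e) (hz₀ : OrderCell r e z₀) :
    ∃ z, OrderCell r e z ∧ ∀ w, OrderCell r e w → potential r ρ z ≤ potential r ρ w := by
  obtain ⟨η, hη, hgap⟩ := exists_add_le_abs_sub (N := N) hrρ (potential r ρ z₀)
  set M := √(2 * potential r ρ z₀)
  let K : Set (Fin N → ℝ) := {z | ∀ i j, e j < e i → r + η ≤ z i - z j} ∩
    Set.Icc (fun _ => -M) (fun _ => M)
  have hclosed : IsClosed {z : Fin N → ℝ | ∀ i j, e j < e i → r + η ≤ z i - z j} := by
    simp only [Set.ofPred_forall]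
    exact isClosed_iInter fun i => isClosed_iInter fun j => isClosed_iInter fun _ =>
      isClosed_le (by fun_prop) (by fun_prop)
  have hK : IsCompact K := isCompact_Icc.inter_left hclosed
  have hsub : ∀ z ∈ K, OrderCell r e z := fun z hz i j hij => by linarith [hz.1 i j hij]
  have hmem : ∀ z, OrderCell r e z → potential r ρ z ≤ potential r ρ z₀ → z ∈ K := by
    intro z hz hV
    have hM := fun i => abs_le.1 (Real.abs_le_sqrt (sq_le_of_potential_le hV i))
    refine ⟨fun i j hij => ?_, fun i => (hM i).1, fun i => (hM i).2⟩
    have h1 := hgap z (hz.separated he) hV i j (fun h => by simp [h] at hij)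
    have h2 := hz i j hij
    rwa [abs_of_pos (hr.trans h2)] at h1
  obtain ⟨z, hzK, hz⟩ := hK.exists_isMinOn ⟨z₀, hmem z₀ hz₀ le_rfl⟩
    (f := potential r ρ) fun z hz =>
      (continuousAt_potential ((hsub z hz).separated he)).continuousWithinAt
  refine ⟨z, hsub z hzK, fun w hw => ?_⟩
  rcases le_total (potential r ρ w) (potential r ρ z₀) with h | h
  · exact hz (hmem w hw h)
  · exact le_trans (hz (hmem z₀ hz₀ le_rfl)) h

theorem potentialGrad_eq_zero_of_isMin {N : ℕ} {r ρ : ℝ} (hr : 0 < r) {e z : Fin N → ℝ}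
    (he : Function.Injective e) (hz : OrderCell r e z)
    (hmin : ∀ w, OrderCell r e w → potential r ρ z ≤ potential r ρ w) (i : Fin N) :
    potentialGrad r ρ z i = 0 := by
  let f : ℝ → Fin N → ℝ := fun t => z + t • Pi.single i 1
  have hf0 : f 0 = z := by simp [f]
  have hf : ∀ j, HasDerivAt (fun t => f t j) ((Pi.single i 1 : Fin N → ℝ) j) 0 := by
    intro j
    simpa [f] using ((hasDerivAt_id (0 : ℝ)).mul_const ((Pi.single i 1 : Fin N → ℝ) j)).const_add
      (z j)
  have hder := hasDerivAt_potential (ρ := ρ) hr hf (by rw [hf0]; exact hz.separated he)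
  have hcont : Continuous f := by fun_prop
  have hloc : IsLocalMin (fun t => potential r ρ (f t)) 0 := by
    have : ∀ᶠ t in 𝓝 (0 : ℝ), OrderCell r e (f t) :=
      hcont.continuousAt.eventually ((isOpen_orderCell r e).mem_nhds (by rw [hf0]; exact hz))
    filter_upwards [this] with t ht
    rw [hf0]
    exact hmin _ ht
  have h := hloc.hasDerivAt_eq_zero hder
  rw [hf0] at h
  simpa [Pi.single_apply] using h

/-- At a critical point the attraction alone balances on a group of vehicles which the others do
not repel, because the repulsion inside the group cancels. -/
theorem sum_eq_zero_of_critical {N : ℕ} {r ρ : ℝ} {z : Fin N → ℝ}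
    (hz : ∀ i, potentialGrad r ρ z i = 0) (S : Finset (Fin N))
    (hS : ∀ i ∈ S, ∀ j ∉ S, pairErr r ρ (z i - z j) = 0) : ∑ i ∈ S, z i = 0 := by
  let f : Fin N → Fin N → ℝ := fun i j => pairSlope r (z i - z j) * pairErr r ρ (z i - z j)
  have hanti : ∀ i j, f i j = -f j i := by
    intro i j
    simp only [f]
    rw [← neg_sub (z j) (z i), pairSlope_mul_pairErr_neg]
  have h1 : ∑ i ∈ S, ∑ j ∈ S, f i j = 0 := by
    have : ∑ i ∈ S, ∑ j ∈ S, f i j = -∑ i ∈ S, ∑ j ∈ S, f i j := by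
      conv_lhs => rw [Finset.sum_comm]
      rw [← Finset.sum_neg_distrib]
      refine Finset.sum_congr rfl fun i _ => ?_
      rw [← Finset.sum_neg_distrib]
      exact Finset.sum_congr rfl fun j _ => hanti j i
    linarith
  have h2 : ∑ i ∈ S, potentialGrad r ρ z i = ∑ i ∈ S, z i + ∑ i ∈ S, ∑ j ∈ S, f i j := by
    rw [← Finset.sum_add_distrib]
    refine Finset.sum_congr rfl fun i hi => ?_
    simp only [potentialGrad]
    congr 1
    symm
    refine Finset.sum_subset (Finset.subset_univ S) fun j _ hj => ?_
    simp only [f]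
    rw [hS i hi j hj, mul_zero]
  rw [h1, Finset.sum_eq_zero fun i _ => hz i] at h2
  linarith

/-- Consecutive vehicles are closer than `ρ` at a critical point: otherwise the vehicles split into
two groups without interaction, both balanced around the target, although one is ahead of the
other. -/
theorem sub_lt_of_critical {N : ℕ} {r ρ : ℝ} (hr : 0 < r) (hrρ : r < ρ) {e z : Fin N → ℝ}
    (he : Function.Injective e) (hz : OrderCell r e z) (hcrit : ∀ i, potentialGrad r ρ z i = 0)
    {a b : Fin N} (hab : e b < e a) (hadj : ∀ k, e k ≤ e b ∨ e a ≤ e k) : z a - z b < ρ := by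
  by_contra! hge
  have hmono : ∀ i j, e j ≤ e i → z j ≤ z i := by
    intro i j h
    rcases h.eq_or_lt with h | h
    · rw [he h]
    · linarith [hz i j h]
  let H : Finset (Fin N) := Finset.univ.filter fun k => e a ≤ e k
  have hH : ∀ k, k ∈ H ↔ e a ≤ e k := fun k => by simp [H]
  have hfar : ∀ i ∈ H, ∀ j ∉ H, ρ ≤ z i - z j := by
    intro i hi j hj
    rw [hH] at hi hj
    have := hmono i a hi
    have := hmono b j ((hadj j).resolve_right hj)
    linarith
  have h1 := sum_eq_zero_of_critical hcrit H fun i hi j hj =>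
    pairErr_eq_zero hrρ ((hfar i hi j hj).trans (le_abs_self _))
  have h2 := sum_eq_zero_of_critical hcrit Hᶜ fun i hi j hj =>
    pairErr_eq_zero hrρ (by
      rw [abs_sub_comm]
      exact (hfar j (by simpa using hj) i (by simpa using hi)).trans (le_abs_self _))
  have h3 : z a ≤ 0 := by
    by_contra! hpos
    have := Finset.sum_pos (s := H) (f := z)
      (fun k hk => hpos.trans_le (hmono k a ((hH k).1 hk))) ⟨a, (hH a).2 le_rfl⟩
    linarith
  have h4 : 0 ≤ z b := by
    by_contra! hneg
    have := Finset.sum_neg (s := Hᶜ) (f := z)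
      (fun k hk => by
        rw [Finset.mem_compl, hH] at hk
        exact (hmono b k ((hadj k).resolve_right hk)).trans_lt hneg)
      ⟨b, by rw [Finset.mem_compl, hH]; exact not_le.2 hab⟩
    linarith
  linarith

end Platoon

/-! ### Absolutely continuous functions -/

theorem LipschitzOnWith.comp_absolutelyContinuousOnInterval {X Y : Type*} [PseudoMetricSpace X]
    [PseudoMetricSpace Y] {f : ℝ → X} {g : X → Y} {K : NNReal} {s : Set X} {a b : ℝ}
    (hg : LipschitzOnWith K g s) (hf : AbsolutelyContinuousOnInterval f a b)
    (hs : ∀ t ∈ Set.uIcc a b, f t ∈ s) :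
    AbsolutelyContinuousOnInterval (fun t => g (f t)) a b := by
  unfold AbsolutelyContinuousOnInterval at hf ⊢
  refine squeeze_zero' (Eventually.of_forall fun E => by positivity) ?_
    (by simpa using hf.const_mul (K : ℝ))
  filter_upwards [mem_inf_of_right (mem_principal_self _)] with E hE
  rw [Finset.mul_sum]
  exact Finset.sum_le_sum fun i hi =>
    hg.dist_le_mul _ (hs _ (hE.1 i hi).1) _ (hs _ (hE.1 i hi).2)

theorem AbsolutelyContinuousOnInterval.finsetSum {ι : Type*} {S : Finset ι} {f : ι → ℝ → ℝ}
    {a b : ℝ} (hf : ∀ i ∈ S, AbsolutelyContinuousOnInterval (f i) a b) :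
    AbsolutelyContinuousOnInterval (fun t => ∑ i ∈ S, f i t) a b := by
  classical
  induction S using Finset.induction_on with
  | empty =>
    simpa using (LipschitzWith.const (0 : ℝ)).lipschitzOnWith.absolutelyContinuousOnInterval
  | insert k S hk ih =>
    simp only [Finset.sum_insert hk]
    exact (hf k (Finset.mem_insert_self _ _)).fun_add
      (ih fun i hi => hf i (Finset.mem_insert_of_mem hi))

theorem AbsolutelyContinuousOnInterval.sub_le_of_ae_deriv_le {f : ℝ → ℝ} {a b C : ℝ} (hab : a ≤ b)
    (hf : AbsolutelyContinuousOnInterval f a b)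
    (hd : ∀ᵐ t, a < t → t ≤ b → ∃ d, HasDerivAt f d t ∧ d ≤ C) : f b - f a ≤ C * (b - a) := by
  rw [← hf.integral_deriv_eq_sub]
  have h : ∫ t in a..b, deriv f t ≤ ∫ _ in a..b, C := by
    refine intervalIntegral.integral_mono_ae_restrict hab hf.intervalIntegrable_deriv
      intervalIntegrable_const ?_
    rw [restrict_Ioc_eq_restrict_Icc.symm]
    filter_upwards [ae_restrict_of_ae hd, ae_restrict_mem measurableSet_Ioc] with t ht htm
    obtain ⟨d, h1, h2⟩ := ht htm.1 htm.2
    rwa [h1.deriv]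
  refine h.trans_eq ?_
  rw [intervalIntegral.integral_const, smul_eq_mul, mul_comm]

/-- A nonnegative Lyapunov function with `W' ≤ -k W` almost everywhere tends to zero: it decreases,
hence `W a - W T ≥ k (T - a) W T`. -/
theorem tendsto_zero_of_ae_deriv_le_neg_mul {W : ℝ → ℝ} {a k : ℝ} (hk : 0 < k)
    (hW : ∀ T, a ≤ T → AbsolutelyContinuousOnInterval W a T) (h0 : ∀ t, a ≤ t → 0 ≤ W t)
    (hd : ∀ᵐ t, a < t → ∃ d, HasDerivAt W d t ∧ d ≤ -k * W t) : Tendsto W atTop (𝓝 0) := by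
  have hanti : ∀ s t, a ≤ s → s ≤ t → W t ≤ W s := by
    intro s t has hst
    have h := AbsolutelyContinuousOnInterval.sub_le_of_ae_deriv_le (C := 0) hst
      ((hW t (has.trans hst)).mono (by
        rw [Set.uIcc_of_le hst, Set.uIcc_of_le (has.trans hst)]
        exact Set.Icc_subset_Icc_left has)) (by
      filter_upwards [hd] with u hu h1 _
      obtain ⟨d, h2, h3⟩ := hu (has.trans_lt h1)
      exact ⟨d, h2, by nlinarith [h0 u (has.trans h1.le)]⟩)
    linarith
  have hle : ∀ t, a < t → W t ≤ W a / k / (t - a) := by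
    intro t hat
    have h := AbsolutelyContinuousOnInterval.sub_le_of_ae_deriv_le (C := -k * W t) hat.le
      (hW t hat.le) (by
      filter_upwards [hd] with u hu h1 h2
      obtain ⟨d, h3, h4⟩ := hu h1
      exact ⟨d, h3, h4.trans (by nlinarith [hanti u t h1.le h2])⟩)
    rw [le_div_iff₀ (by linarith), le_div_iff₀ hk]
    linarith [h0 t hat.le]
  refine tendsto_of_tendsto_of_tendsto_of_le_of_le' tendsto_const_nhds
    (h := fun t => W a / k / (t - a)) ?_ ?_ ?_
  · exact (tendsto_atTop_add_const_right atTop (-a) tendsto_id).const_div_atTop _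
  · filter_upwards [eventually_ge_atTop a] with t ht using h0 t ht
  · filter_upwards [eventually_gt_atTop a] with t ht using hle t ht

namespace Platoon

theorem lipschitzOnWith_pairErr {r ρ η : ℝ} (hη : 0 < η) :
    LipschitzOnWith (Real.toNNReal (1 / η ^ 2)) (pairErr r ρ) {u | r + η ≤ |u|} := by
  refine LipschitzOnWith.of_dist_le_mul fun u hu w hw => ?_
  rw [Real.coe_toNNReal _ (by positivity), Real.dist_eq, Real.dist_eq]
  have hu' : η ≤ |u| - r := by linarith [show r + η ≤ |u| from hu]
  have hw' : η ≤ |w| - r := by linarith [show r + η ≤ |w| from hw]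
  have hu0 := hη.trans_le hu'
  have hw0 := hη.trans_le hw'
  calc |pairErr r ρ u - pairErr r ρ w|
      ≤ |(1 / (|u| - r) - 1 / (ρ - r)) - (1 / (|w| - r) - 1 / (ρ - r))| := by
        unfold pairErr
        rw [max_comm 0, max_comm 0]
        exact abs_max_sub_max_le_abs _ _ _
    _ = abs (|w| - |u|) / ((|u| - r) * (|w| - r)) := by
        rw [show (1 / (|u| - r) - 1 / (ρ - r)) - (1 / (|w| - r) - 1 / (ρ - r)) =
          (|w| - |u|) / ((|u| - r) * (|w| - r)) by field_simp; ring, abs_div,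
          abs_of_pos (mul_pos hu0 hw0)]
    _ ≤ |u - w| / (η * η) := by
        refine div_le_div₀ (abs_nonneg _) ?_ (by positivity) (by gcongr)
        rw [abs_sub_comm u w]
        exact abs_abs_sub_abs_le w u
    _ = 1 / η ^ 2 * |u - w| := by ring

theorem absolutelyContinuousOnInterval_potential {N : ℕ} {r ρ η a b : ℝ} (hη : 0 < η)
    {z : ℝ → Fin N → ℝ} (hz : ∀ i, AbsolutelyContinuousOnInterval (fun t => z t i) a b)
    (hgap : ∀ t ∈ Set.uIcc a b, ∀ i j, i ≠ j → r + η ≤ |z t i - z t j|) :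
    AbsolutelyContinuousOnInterval (fun t => potential r ρ (z t)) a b := by
  have hconst : ∀ C : ℝ, AbsolutelyContinuousOnInterval (fun _ : ℝ => C) a b := fun C =>
    (LipschitzWith.const C).lipschitzOnWith.absolutelyContinuousOnInterval
  have hpair : ∀ i j,
      AbsolutelyContinuousOnInterval (fun t => pairErr r ρ (z t i - z t j)) a b := by
    intro i j
    rcases eq_or_ne i j with rfl | hij
    · simpa using hconst _
    · exact (lipschitzOnWith_pairErr hη).comp_absolutelyContinuousOnInterval
        ((hz i).fun_sub (hz j)) fun t ht => hgap t ht i j hij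
  unfold potential
  simp only [div_eq_inv_mul, sq]
  exact ((AbsolutelyContinuousOnInterval.finsetSum fun i _ =>
      (hz i).fun_mul (hz i)).const_mul _).fun_add
    ((AbsolutelyContinuousOnInterval.finsetSum fun i _ =>
      AbsolutelyContinuousOnInterval.finsetSum fun j _ =>
        (hpair i j).fun_mul (hpair i j)).const_mul _)

/-! ### Gradient flows with bounded gains -/

/-- From time `a` on, as long as the gaps exceed `r`, the curve `z` follows the negative gradient of
the potential, with a gain between `minGain` and `c` in each coordinate. -/
structure IsGainFlow {N : ℕ} (r ρ c a : ℝ) (z : ℝ → Fin N → ℝ) : Prop where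
  ac : ∀ i T, a ≤ T → AbsolutelyContinuousOnInterval (fun t => z t i) a T
  flow : ∀ᵐ t, a < t → Separated r (z t) → ∃ v : Fin N → ℝ,
    (∀ i, HasDerivAt (fun t => z t i) (v i) t) ∧
    ∀ i, ∃ κ, minGain r c (z t) i ≤ κ ∧ κ ≤ c ∧ v i = -κ * potentialGrad r ρ (z t) i

variable {N : ℕ} {r ρ c a : ℝ} {z : ℝ → Fin N → ℝ}

theorem IsGainFlow.continuousOn (h : IsGainFlow r ρ c a z) (i : Fin N) {T : ℝ} (hT : a ≤ T) :
    ContinuousOn (fun t => z t i) (Set.Icc a T) := by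
  simpa [Set.uIcc_of_le hT] using (h.ac i T hT).continuousOn

/-- The derivative of the potential along the flow. -/
theorem IsGainFlow.ae_hasDerivAt_potential (h : IsGainFlow r ρ c a z) (hr : 0 < r) :
    ∀ᵐ t, a < t → Separated r (z t) → ∃ d, HasDerivAt (fun t => potential r ρ (z t)) d t ∧
      ∀ k, (∀ i, k ≤ minGain r c (z t) i) → d ≤ -k * ∑ i, potentialGrad r ρ (z t) i ^ 2 := by
  filter_upwards [h.flow] with t ht hat hsep
  obtain ⟨v, hv, hκ⟩ := ht hat hsep
  refine ⟨_, hasDerivAt_potential hr hv hsep, fun k hk => ?_⟩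
  rw [Finset.mul_sum]
  refine Finset.sum_le_sum fun i _ => ?_
  obtain ⟨κ, h1, -, h3⟩ := hκ i
  rw [h3]
  nlinarith [mul_le_mul_of_nonneg_right ((hk i).trans h1) (sq_nonneg (potentialGrad r ρ (z t) i))]

theorem IsGainFlow.potential_le (h : IsGainFlow r ρ c a z) (hr : 0 < r) (hc : 0 < c) {η T : ℝ}
    (hη : 0 < η) (hT : a ≤ T)
    (hgap : ∀ t, a ≤ t → t ≤ T → ∀ i j, i ≠ j → r + η ≤ |z t i - z t j|) :
    potential r ρ (z T) ≤ potential r ρ (z a) := by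
  have hac := absolutelyContinuousOnInterval_potential (ρ := ρ) hη (fun i => h.ac i T hT)
    (fun t ht => by
      rw [Set.uIcc_of_le hT] at ht
      exact hgap t ht.1 ht.2)
  have := hac.sub_le_of_ae_deriv_le (C := 0) hT (by
    filter_upwards [h.ae_hasDerivAt_potential hr] with t ht h1 h2
    obtain ⟨d, h3, h4⟩ := ht h1 fun i j hij => by linarith [hgap t h1.le h2 i j hij]
    exact ⟨d, h3, by simpa using h4 0 fun i => (minGain_pos hc _ _).le⟩)
  linarith

/-- Collision avoidance: by the time the gaps could first fall to `r + η / 2`, the potential would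
not have increased, which forces gaps of at least `r + η`. -/
theorem IsGainFlow.exists_add_le_gap (h : IsGainFlow r ρ c a z) (hr : 0 < r) (hrρ : r < ρ)
    (hc : 0 < c) (h0 : Separated r (z a)) :
    ∃ η, 0 < η ∧ ∀ t, a ≤ t → ∀ i j, i ≠ j → r + η ≤ |z t i - z t j| := by
  obtain ⟨η, hη, hgap⟩ := exists_add_le_abs_sub (N := N) hrρ (potential r ρ (z a))
  refine ⟨η / 2, half_pos hη, fun T hT i j hij => ?_⟩
  by_contra! hlt
  let B : Set ℝ := ⋃ i, ⋃ j, ⋃ _ : i ≠ j, {t ∈ Set.Icc a T | |z t i - z t j| ≤ r + η / 2}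
  have hBmem : ∀ t, t ∈ B ↔
      ∃ i j, i ≠ j ∧ t ∈ Set.Icc a T ∧ |z t i - z t j| ≤ r + η / 2 := by
    intro t
    simp only [B, Set.mem_iUnion, exists_prop, Set.mem_ofPred_eq]
  have hBclosed : IsClosed B := by
    refine isClosed_iUnion_of_finite fun i => isClosed_iUnion_of_finite fun j =>
      isClosed_iUnion_of_finite fun _ => ?_
    have hcont : ContinuousOn (fun t => |z t i - z t j|) (Set.Icc a T) :=
      ((h.continuousOn i hT).sub (h.continuousOn j hT)).abs
    exact hcont.preimage_isClosed_of_isClosed isClosed_Icc isClosed_Iic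
  have hBc : IsCompact B := isCompact_Icc.of_isClosed_subset hBclosed fun t ht => by
    obtain ⟨_, _, _, h, _⟩ := (hBmem t).1 ht
    exact h
  obtain ⟨τ, hτB, hτ⟩ := hBc.exists_isLeast ⟨T, (hBmem T).2 ⟨i, j, hij, ⟨hT, le_rfl⟩, hlt.le⟩⟩
  obtain ⟨k, l, hkl, ⟨haτ, hτT⟩, hkl'⟩ := (hBmem τ).1 hτB
  have hbefore : ∀ t, a ≤ t → t < τ → ∀ i j, i ≠ j → r + η / 2 ≤ |z t i - z t j| := by
    intro t hat htτ i j hij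
    by_contra! hh
    exact absurd (hτ ((hBmem t).2 ⟨i, j, hij, ⟨hat, htτ.le.trans hτT⟩, hh.le⟩)) (not_le.2 htτ)
  have hne : a ≠ τ := by
    rintro rfl
    linarith [hgap _ h0 le_rfl k l hkl]
  have hlt' : a < τ := lt_of_le_of_ne haτ hne
  have hat : ∀ t, a ≤ t → t ≤ τ → ∀ i j, i ≠ j → r + η / 2 ≤ |z t i - z t j| := by
    intro t hat htτ i j hij
    rcases htτ.lt_or_eq with htτ | rfl
    · exact hbefore t hat htτ i j hij
    · have hcont : ContinuousOn (fun t => |z t i - z t j|) (Set.Icc a t) :=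
        ((h.continuousOn i haτ).sub (h.continuousOn j haτ)).abs
      have htend : Tendsto (fun s => |z s i - z s j|) (𝓝[<] t) (𝓝 |z t i - z t j|) :=
        ((hcont t ⟨haτ, le_rfl⟩).mono_of_mem_nhdsWithin (Icc_mem_nhdsLT hlt'))
      refine ge_of_tendsto htend ?_
      filter_upwards [Ioo_mem_nhdsLT hlt'] with s hs using hbefore s hs.1.le hs.2 i j hij
  have hpot := h.potential_le hr hc (half_pos hη) haτ hat
  have := hgap (z τ) (fun i j hij => by linarith [hat τ haτ le_rfl i j hij]) hpot k l hkl
  linarith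

/-- The order of the vehicles is preserved. -/
theorem IsGainFlow.orderCell (h : IsGainFlow r ρ c a z) (hr : 0 < r)
    (hsep : ∀ t, a ≤ t → Separated r (z t)) {t : ℝ} (ht : a ≤ t) : OrderCell r (z a) (z t) := by
  intro i j hij
  have hne : i ≠ j := fun h => by simp [h] at hij
  have hcont : ContinuousOn (fun t => z t i - z t j) (Set.Icc a t) :=
    (h.continuousOn i ht).sub (h.continuousOn j ht)
  have hpos : 0 < z t i - z t j := by
    by_contra! hle
    obtain ⟨s, hs, hs0⟩ := intermediate_value_Icc' ht hcont
      (show (0 : ℝ) ∈ Set.Icc (z t i - z t j) (z a i - z a j) from ⟨hle, by linarith⟩)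
    have := hsep s hs.1 i j hne
    simp only at hs0
    rw [hs0, abs_zero] at this
    linarith
  have := hsep t ht i j hne
  rwa [abs_of_pos hpos] at this

/-- The flow converges to a critical point of the potential in its order cell. Strong convexity
bounds the excess of the potential over its minimum by half the squared gradient, so the excess
decays; it also bounds the squared distance to the minimizer by twice the excess. -/
theorem IsGainFlow.exists_tendsto (h : IsGainFlow r ρ c a z) (hr : 0 < r) (hrρ : r < ρ)
    (hc : 0 < c) (h0 : Separated r (z a)) :
    ∃ w, OrderCell r (z a) w ∧ (∀ i, potentialGrad r ρ w i = 0) ∧ Tendsto z atTop (𝓝 w) := by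
  obtain ⟨η, hη, hgap⟩ := h.exists_add_le_gap hr hrρ hc h0
  have he : Function.Injective (z a) := by
    intro i j hij
    by_contra hne
    have := h0 i j hne
    rw [hij, sub_self, abs_zero] at this
    linarith
  have hsep : ∀ t, a ≤ t → Separated r (z t) := fun t ht i j hij => by
    linarith [hgap t ht i j hij]
  have hcell : ∀ t, a ≤ t → OrderCell r (z a) (z t) := fun t ht => h.orderCell hr hsep ht
  obtain ⟨w, hw, hmin⟩ := exists_isMin_potential (ρ := ρ) hr hrρ he (hcell a le_rfl)
  have hcrit := potentialGrad_eq_zero_of_isMin hr he hw hmin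
  obtain ⟨k, hk, hgain⟩ := exists_le_minGain (N := N) (r := r) hc hη
  refine ⟨w, hw, hcrit, ?_⟩
  have hexcess : Tendsto (fun t => potential r ρ (z t) - potential r ρ w) atTop (𝓝 0) := by
    refine tendsto_zero_of_ae_deriv_le_neg_mul (a := a) (k := 2 * k) (by linarith) ?_ ?_ ?_
    · intro T hT
      have hconst : AbsolutelyContinuousOnInterval (fun _ : ℝ => potential r ρ w) a T :=
        (LipschitzWith.const _).lipschitzOnWith.absolutelyContinuousOnInterval
      exact (absolutelyContinuousOnInterval_potential hη (fun i => h.ac i T hT) fun t ht => by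
        rw [Set.uIcc_of_le hT] at ht
        exact hgap t ht.1).fun_sub hconst
    · exact fun t ht => sub_nonneg.2 (hmin _ (hcell t ht))
    · filter_upwards [h.ae_hasDerivAt_potential hr] with t ht hat
      obtain ⟨d, hd, hd'⟩ := ht hat (hsep t hat.le)
      refine ⟨d, hd.sub_const _, (hd' k (hgain _ (hgap t hat.le))).trans ?_⟩
      have hconv := potential_add_le (ρ := ρ) hr he (hcell t hat.le) hw
      have hsq : 0 ≤ (∑ i, potentialGrad r ρ (z t) i ^ 2) / 2 +
          ∑ i, potentialGrad r ρ (z t) i * (w i - z t i) + (∑ i, (w i - z t i) ^ 2) / 2 := by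
        have : 0 ≤ ∑ i, (potentialGrad r ρ (z t) i + (w i - z t i)) ^ 2 := by positivity
        simp only [add_sq, Finset.sum_add_distrib, mul_assoc, ← Finset.mul_sum] at this
        linarith
      nlinarith
  rw [tendsto_pi_nhds]
  intro i
  have hdist : ∀ᶠ t in atTop, ‖z t i - w i‖ ≤ √(2 * (potential r ρ (z t) - potential r ρ w)) := by
    filter_upwards [eventually_ge_atTop a] with t ht
    refine Real.abs_le_sqrt ?_
    have hconv := potential_add_le (ρ := ρ) hr he hw (hcell t ht)
    simp only [hcrit, zero_mul, Finset.sum_const_zero, add_zero] at hconv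
    have := Finset.single_le_sum (f := fun i => (z t i - w i) ^ 2) (fun j _ => sq_nonneg _)
      (Finset.mem_univ i)
    linarith
  rw [← tendsto_sub_nhds_zero_iff]
  refine squeeze_zero_norm' hdist ?_
  simpa using (hexcess.const_mul 2).sqrt

/-! ### The closed loop -/

/-- In the frame of the virtual target, the closed loop is a gradient flow with bounded gains. -/
theorem IsClosedLoop.isGainFlow {N : ℕ} {P : Params} (hr : 0 < P.r) (hrρ : P.r < P.ρ)
    (hρR : P.ρ < P.R) (hc : 0 < P.c) {T₁ : ℝ} {xd : ℝ → ℝ} (hxd : ∀ t, HasDerivAt xd P.vd t)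
    {x y : Fin N → ℝ → ℝ} (hloop : IsClosedLoop P (fun φ => φ) T₁ xd x y) :
    IsGainFlow P.r P.ρ P.c T₁ (fun t i => x i t - xd t) where
  ac i T hT := by
    have hxd1 : ContDiff ℝ 1 xd := by
      rw [contDiff_one_iff_deriv, show deriv xd = fun _ => P.vd from funext fun t => (hxd t).deriv]
      exact ⟨fun t => (hxd t).differentiableAt, continuous_const⟩
    exact (hloop.ac_x i T hT).fun_sub hxd1.contDiffOn.absolutelyContinuousOnInterval
  flow := by
    filter_upwards [hloop.dynamics] with t ht hat hsep
    obtain ⟨u, hu, hder⟩ := ht hat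
    refine ⟨fun i => u.1 i - P.vd, fun i => (hder i).1.sub (hxd t), fun i => ?_⟩
    exact lon_velocity_of_mem_regularizedInputs hr hrρ hρR hc
      (fun i j hij => by simpa using hsep i j hij) hu i

theorem IsClosedLoop.tendsto_lateral {N : ℕ} {P : Params} (hc : 0 < P.c) {T₁ : ℝ} {xd : ℝ → ℝ}
    {x y : Fin N → ℝ → ℝ} (hloop : IsClosedLoop P (fun φ => φ) T₁ xd x y) (i : Fin N) :
    Tendsto (y i) atTop (𝓝 P.yd) := by
  have hsq : Tendsto (fun t => (y i t - P.yd) * (y i t - P.yd)) atTop (𝓝 0) := by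
    refine tendsto_zero_of_ae_deriv_le_neg_mul (a := T₁) (k := 2 * (P.c / (1 + P.c)))
      (by positivity) (fun T hT => ?_) (fun t _ => mul_self_nonneg _) ?_
    · have hconst : AbsolutelyContinuousOnInterval (fun _ : ℝ => P.yd) T₁ T :=
        (LipschitzWith.const _).lipschitzOnWith.absolutelyContinuousOnInterval
      have := (hloop.ac_y i T hT).fun_sub hconst
      exact this.fun_mul this
    · filter_upwards [hloop.dynamics] with t ht hat
      obtain ⟨u, hu, hder⟩ := ht hat
      obtain ⟨κ, h1, -, h3⟩ := lat_velocity_of_mem_regularizedInputs hc hu i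
      have hd := (hder i).2.sub_const P.yd
      refine ⟨_, hd.mul hd, ?_⟩
      simp only at h3
      rw [h3]
      nlinarith [mul_le_mul_of_nonneg_right h1 (mul_self_nonneg (y i t - P.yd))]
  rw [← tendsto_sub_nhds_zero_iff, tendsto_zero_iff_abs_tendsto_zero]
  have h := hsq.sqrt
  simp only [Real.sqrt_mul_self_eq_abs, Real.sqrt_zero] at h
  exact h

theorem exists_perm_strictAnti {N : ℕ} {e : Fin N → ℝ} (he : Function.Injective e) :
    ∃ s : Equiv.Perm (Fin N), StrictAnti fun k => e (s k) := by
  refine ⟨Tuple.sort (fun i => -e i), ?_⟩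
  have hmono := Tuple.monotone_sort (fun i => -e i)
  have hanti : Antitone fun k => e (Tuple.sort (fun i => -e i) k) := fun k l hkl =>
    neg_le_neg_iff.1 (hmono hkl)
  exact hanti.strictAnti_of_injective (he.comp (Equiv.injective _))

end Platoon

theorem theorem5p2 (N : ℕ) (P : Platoon.Params)
    (hr : 0 < P.r) (hrρ : P.r < P.ρ) (hρR : P.ρ < P.R) (hc : 0 < P.c) (hvd : 0 < P.vd)
    (T₁ : ℝ) (xd : ℝ → ℝ) (hxd : ∀ t, HasDerivAt xd P.vd t)
    (x y : Fin N → ℝ → ℝ)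
    (hloop : Platoon.IsClosedLoop P (fun φ => φ) T₁ xd x y)
    (hspacing : ∀ i j, i ≠ j → P.ρ ≤ |x i T₁ - x j T₁|) :
    -- the merging problem splits into the lateral and the longitudinal one
    (∀ (a : ℝ) (p : Platoon.State N) (i : Fin N) (gc gm : ℝ) (w : Platoon.Decision N),
      Platoon.IsOptimal (Platoon.feasible P (fun φ => φ) a p.1 (p.2 i) i gc gm)
          (Platoon.cost P p.1 i) w ↔
        Platoon.IsOptimal (Platoon.latFeasible P (fun φ => φ) (p.2 i) gc)
            (Platoon.latCost P) w.toLatDecision ∧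
          Platoon.IsOptimal (Platoon.lonFeasible P (fun φ => φ) a p.1 i gm)
            (Platoon.lonCost P p.1 i) w.toLonDecision) ∧
    -- lateral convergence
    (∀ i, Tendsto (y i) atTop (𝓝 P.yd)) ∧
    -- platoon with some ordering `s`, from head to tail
    (∃ s : Equiv.Perm (Fin N),
      (∀ t, T₁ ≤ t → StrictAnti (fun k => x (s k) t)) ∧
      ∀ (k : ℕ) (hk : k + 1 < N), ∃ l, P.r < l ∧ l < P.ρ ∧
        Tendsto (fun t => |x (s ⟨k, Nat.lt_of_succ_lt hk⟩) t - x (s ⟨k + 1, hk⟩) t|)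
          atTop (𝓝 l)) ∧
    -- cruising; the velocities exist at almost every time
    (∀ i, Tendsto (deriv (x i)) (atTop ⊓ ae volume) (𝓝 P.vd)) ∧
    -- collision avoidance
    (∀ i j, i ≠ j → ∀ t, T₁ ≤ t → P.r ≤ |x i t - x j t|) := by
  open Platoon in
  have hflow := hloop.isGainFlow hr hrρ hρR hc hxd
  have hsep₀ : Separated P.r fun i => x i T₁ - xd T₁ := fun i j hij => by
    simpa using hrρ.trans_le (hspacing i j hij)
  obtain ⟨η, hη, hgap⟩ := hflow.exists_add_le_gap hr hrρ hc hsep₀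
  simp only [sub_sub_sub_cancel_right] at hgap
  have hsep : ∀ t, T₁ ≤ t → Separated P.r fun i => x i t - xd t := fun t ht i j hij => by
    rw [sub_sub_sub_cancel_right]
    linarith [hgap t ht i j hij]
  obtain ⟨w, hw, hcrit, htend⟩ := hflow.exists_tendsto hr hrρ hc hsep₀
  have he : Function.Injective fun i => x i T₁ - xd T₁ := by
    intro i j hij
    by_contra hne
    have h := hsep₀ i j hne
    simp only at hij h
    rw [hij, sub_self, abs_zero] at h
    linarith
  refine ⟨fun a p i gc gm w => isOptimal_iff_lat_lon P _ a p.1 (p.2 i) i gc gm w,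
    hloop.tendsto_lateral hc, ?_, fun i => ?_, fun i j hij t ht => by linarith [hgap t ht i j hij]⟩
  · obtain ⟨s, hs⟩ := exists_perm_strictAnti he
    refine ⟨s, fun t ht k l hkl => ?_, fun k hk => ?_⟩
    · have := hflow.orderCell hr hsep ht (s k) (s l) (hs hkl)
      simp only [sub_sub_sub_cancel_right] at this
      linarith
    · set m : Fin N := ⟨k, Nat.lt_of_succ_lt hk⟩ with hm
      set n : Fin N := ⟨k + 1, hk⟩ with hn
      have hmn : m < n := Fin.mk_lt_mk.2 (Nat.lt_succ_self k)
      have hpos := hw (s m) (s n) (hs hmn)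
      refine ⟨w (s m) - w (s n), hpos,
        sub_lt_of_critical hr hrρ he hw hcrit (hs hmn) fun q => ?_, ?_⟩
      · obtain ⟨q, rfl⟩ := s.surjective q
        rcases le_or_gt q m with h | h
        · exact Or.inr (hs.antitone h)
        · exact Or.inl (hs.antitone (show n ≤ q from Fin.mk_le_of_le_val (Fin.lt_def.1 h)))
      · have h := ((tendsto_pi_nhds.1 htend (s m)).sub (tendsto_pi_nhds.1 htend (s n))).abs
        simpa only [sub_sub_sub_cancel_right, abs_of_pos (hr.trans hpos)] using h
  · -- the relative velocity is at most `c` times the gradient, which tends to `0`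
    have hgrad : Tendsto (fun t => P.c * |potentialGrad P.r P.ρ (fun j => x j t - xd t) i|) atTop
        (𝓝 0) := by
      have h := (continuousAt_potentialGrad (ρ := P.ρ) hr (hw.separated he) i).tendsto.comp htend
      rw [hcrit i] at h
      simpa using h.abs.const_mul P.c
    rw [← tendsto_sub_nhds_zero_iff]
    refine squeeze_zero_norm' ?_ (hgrad.mono_left inf_le_left)
    filter_upwards [mem_inf_of_left (Ioi_mem_atTop T₁),
      mem_inf_of_right hloop.dynamics] with t hat ht
    obtain ⟨u, hu, hder⟩ := ht hat
    obtain ⟨κ, h1, h2, h3⟩ := lon_velocity_of_mem_regularizedInputs hr hrρ hρR hc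
      (fun i j hij => by simpa using hsep t (le_of_lt hat) i j hij) hu i
    have hκ : 0 ≤ κ := (minGain_pos hc _ _).le.trans h1
    rw [(hder i).1.deriv, h3, norm_mul, norm_neg, Real.norm_eq_abs, Real.norm_eq_abs,
      abs_of_nonneg hκ]
    gcongr
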